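/- Let $R=k[x_1,\dots,x_n]$ be the standard graded polynomial ring over a field $k$. For $S\subseteq\{1,\dots,n\}$ let $\mathfrak m_S=(x_s : s\in S)\subseteq R$ (so $\mathfrak m_\emptyset=0$). For a homogeneous ideal $I$ let $\beta_{i,j}(I)$ be its graded Betti numbers, i.e. the number of summands $R(-j)$ in the $i$-th module of a minimal graded free resolution $\cdots\to F_1\to F_0\to I\to 0$. Let $J,K\subseteq\{1,\dots,n\}$, let $a\ge b\ge 1$ be integers, put $A=J\setminus K$, $C=J\cap K$, and $$U=\mathfrak m_C^{a}+\mathfrak m_A\mathfrak m_C^{a-1}+\cdots+\mathfrak m_A^{a-b}\mathfrak m_C^{b}.$$ Then for all $i\ge 0$ $$\beta_{i,i+a}(U)=\binom{|C|+a-1}{a+i}\binom{a+i-1}{i}+\sum_{j=1}^{a-b}\sum_{l=0}^{|A|-1}\binom{l+j-1}{j-1}\binom{|C|+a-j-1}{a-j}\binom{|C|+l}{i},$$ and $\beta_{i,j}(U)=0$ for all $i,j\ge 0$ with $j\ne i+a$. In particular $U$ is generated by forms of degree $a$ and has a linear resolution. Moreover, if $K\subseteq J$ and $I=\mathfrak m_J^a\cap\mathfrak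 m_K^b$, then for all $i\ge 0$ $$\beta_{i,i+a}(I)=\binom{|K|+a-1}{a+i}\binom{a+i-1}{i}+\sum_{j=1}^{a-b}\sum_{l=0}^{|J\setminus K|-1}\binom{l+j-1}{j-1}\binom{|K|+a-j-1}{a-j}\binom{|K|+l}{i},$$ and $\beta_{i,j}(I)=0$ for all $i,j\ge 0$ with $j\ne i+a$. -/

import Mathlib

/-- An element `v` of the graded free module `⨁ₛ R(-deg s)`, with `R = 𝕜[x_σ]` standard graded, is
homogeneous of degree `m`: every monomial occurring in the coordinate of `v` at `s` has
degree `m - deg s` (so that coordinate is zero if `m < deg s`). -/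
def IsHomogeneousVec {σ 𝕜 ι : Type*} [Field 𝕜] (deg : ι → ℕ)
    (v : ι →₀ MvPolynomial σ 𝕜) (m : ℕ) : Prop :=
  ∀ s, ∀ e ∈ (v s).support, e.degree + deg s = m

/-- A minimal graded free resolution `⋯ → F₂ → F₁ → F₀ → I → 0` of an ideal `I` of the standard
graded polynomial ring `R = 𝕜[x_σ]`, where `Fᵢ = ⨁ₛ R(-deg i s)`, the sum over the finite set
`gens i`. -/
structure MinimalGradedFreeResolution {σ 𝕜 : Type*} [Field 𝕜]
    (I : Ideal (MvPolynomial σ 𝕜)) where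
  /-- index set of the homogeneous basis of `Fᵢ` -/
  gens : ℕ → Type
  finite_gens : ∀ i, Finite (gens i)
  /-- degrees of the basis elements of `Fᵢ` -/
  deg : ∀ i, gens i → ℕ
  /-- the differential `Fᵢ₊₁ → Fᵢ` -/
  d : ∀ i, (gens (i + 1) →₀ MvPolynomial σ 𝕜) →ₗ[MvPolynomial σ 𝕜] (gens i →₀ MvPolynomial σ 𝕜)
  /-- the augmentation `F₀ → I ⊆ R` -/
  aug : (gens 0 →₀ MvPolynomial σ 𝕜) →ₗ[MvPolynomial σ 𝕜] MvPolynomial σ 𝕜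
  /-- the differentials are homogeneous of degree `0` -/
  d_homogeneous : ∀ i v m, IsHomogeneousVec (deg (i + 1)) v m → IsHomogeneousVec (deg i) (d i v) m
  /-- the augmentation is homogeneous of degree `0` -/
  aug_homogeneous : ∀ v m, IsHomogeneousVec (deg 0) v m → (aug v).IsHomogeneous m
  range_aug : LinearMap.range aug = I
  exact_zero : Function.Exact (d 0) aug
  exact_succ : ∀ i, Function.Exact (d (i + 1)) (d i)
  /-- minimality: the image of `Fᵢ₊₁` lies in `(x_σ) Fᵢ` -/
  minimal : ∀ i v s, d i v s ∈ Ideal.span (Set.range (MvPolynomial.X : σ → MvPolynomial σ 𝕜))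

/-- The number of summands `R(-j)` in the `i`-th module of the resolution. -/
noncomputable def MinimalGradedFreeResolution.betti {σ 𝕜 : Type*} [Field 𝕜]
    {I : Ideal (MvPolynomial σ 𝕜)} (F : MinimalGradedFreeResolution I) (i j : ℕ) : ℕ :=
  Nat.card {s : F.gens i // F.deg i s = j}

open Classical in
/-- The graded Betti number `β_{i,j}(I)`: the number of summands `R(-j)` in the `i`-th module of
a minimal graded free resolution of `I`. Such a resolution exists, and is unique up to isomorphism,
for every homogeneous ideal of a polynomial ring in finitely many variables. -/
noncomputable def gradedBetti {σ 𝕜 : Type*} [Field 𝕜]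
    (I : Ideal (MvPolynomial σ 𝕜)) (i j : ℕ) : ℕ :=
  if h : Nonempty (MinimalGradedFreeResolution I) then h.some.betti i j else 0

/-- `I` is generated by forms of degree `d` and `β_{i,j}(I) = 0` for all `j ≠ i + d`. -/
def HasLinearResolution {σ 𝕜 : Type*} [Field 𝕜] (I : Ideal (MvPolynomial σ 𝕜)) (d : ℕ) : Prop :=
  (∃ S : Set (MvPolynomial σ 𝕜), (∀ f ∈ S, f.IsHomogeneous d) ∧ I = Ideal.span S) ∧
    ∀ i j, j ≠ i + d → gradedBetti I i j = 0

/-- The ideal `𝔪_J = (x_j : j ∈ J)` of `𝕜[x_σ]`. -/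
noncomputable def varIdeal (𝕜 : Type*) {σ : Type*} [Field 𝕜] (J : Finset σ) :
    Ideal (MvPolynomial σ 𝕜) :=
  Ideal.span (MvPolynomial.X '' (J : Set σ))

/-- The ideal `U = 𝔪_C ^ a + 𝔪_A 𝔪_C ^ (a - 1) + ⋯ + 𝔪_A ^ (a - b) 𝔪_C ^ b`, where `A = J \ K`
and `C = J ∩ K`. -/
noncomputable def idealU (𝕜 : Type*) {σ : Type*} [DecidableEq σ] [Field 𝕜] (J K : Finset σ)
    (a b : ℕ) : Ideal (MvPolynomial σ 𝕜) :=
  ∑ j ∈ Finset.range (a - b + 1), varIdeal 𝕜 (J \ K) ^ j * varIdeal 𝕜 (J ∩ K) ^ (a - j)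

/-! Write `r = a - b`. Factoring `𝔪_C ^ b` out of every summand and expanding binomially gives `U =
𝔪_C ^ b * (𝔪_C + 𝔪_A) ^ r`, which allows an induction on the variables in `A` and on `r`.

Adding a variable `y` to `J` with `y ∉ C` and `y ∉ J` turns `I = 𝔪_C ^ b * 𝔪_J ^ (r + 1)` into `I +
y L`, where `L = 𝔪_C ^ b * (𝔪_J + (y)) ^ r` contains `I`. Since `y` is a nonzerodivisor modulo `I`,
the sequence `0 → I(-1) → I ⊕ L(-1) → I + y L → 0` with first map `f ↦ (y f, -f)` is exact. The
mapping cone of linear resolutions of `I` and `L` is again linear, hence minimal, so the Betti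
numbers obey `β_i(I + yL) = β_i(I) + β_i(L) + β_{i-1}(I)` (`HasLinearBetti.sup_span_X_mul`). The
closed formulas satisfy the same recursion (`powerBetti_succ_succ`, `mixedBetti_succ_succ`). The
pure powers `𝔪_C ^ a` start the induction and come from the same cone, beginning with the zero and
unit ideals.

As `gradedBetti` is read off a chosen resolution, uniqueness of Betti numbers is also needed
(`betti_le`). For `K ⊆ J` a degree count on monomials identifies `𝔪_J ^ a ∩ 𝔪_K ^ b` with `U`. -/

/-! ### Linear maps out of free modules. -/

section LinearMaps

variable {R : Type*} [CommSemiring R] {ι κ : Type*}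

lemma Finsupp.map_eq_sum_smul [Fintype ι] {N : Type*} [AddCommMonoid N] [Module R N]
    (g : (ι →₀ R) →ₗ[R] N) (v : ι →₀ R) : g v = ∑ s, v s • g (Finsupp.single s 1) := by
  conv_lhs => rw [← Finsupp.univ_sum_single v]
  rw [map_sum]
  refine Finset.sum_congr rfl fun s _ => ?_
  rw [← map_smul, Finsupp.smul_single_one]

lemma Finsupp.map_apply_eq_sum_mul [Fintype ι] (g : (ι →₀ R) →ₗ[R] (κ →₀ R)) (v : ι →₀ R)
    (t : κ) : g v t = ∑ s, v s * g (Finsupp.single s 1) t := by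
  rw [Finsupp.map_eq_sum_smul, Finsupp.finsetSum_apply]
  rfl

lemma Finsupp.map_linearCombination_eq {N : Type*} [AddCommMonoid N] [Module R N]
    (g : (ι →₀ R) →ₗ[R] N) (D : (κ →₀ R) →ₗ[R] N) {x : ι → κ →₀ R}
    (hx : ∀ s, D (x s) = g (Finsupp.single s 1)) (v : ι →₀ R) :
    D (Finsupp.linearCombination R x v) = g v := by
  refine LinearMap.congr_fun (f := D ∘ₗ Finsupp.linearCombination R x) ?_ v
  ext s
  simp [hx]

lemma Finsupp.exists_lift {N : Type*} [AddCommMonoid N] [Module R N]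
    (g : (ι →₀ R) →ₗ[R] N) (D : (κ →₀ R) →ₗ[R] N) (h : ∀ v, ∃ w, D w = g v) :
    ∃ φ : (ι →₀ R) →ₗ[R] (κ →₀ R), ∀ v, D (φ v) = g v := by
  choose x hx using fun s => h (Finsupp.single s 1)
  exact ⟨Finsupp.linearCombination R x, Finsupp.map_linearCombination_eq g D hx⟩

end LinearMaps

/-! ### Homogeneous components in graded free modules. -/

section HomogeneousVectors

variable {σ 𝕜 : Type*} [Field 𝕜] {ι κ : Type*}

lemma IsHomogeneousVec.zero (deg : ι → ℕ) (m : ℕ) :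
    IsHomogeneousVec deg (0 : ι →₀ MvPolynomial σ 𝕜) m := by
  intro s e he
  simp at he

lemma IsHomogeneousVec.add {deg : ι → ℕ} {m : ℕ} {v w : ι →₀ MvPolynomial σ 𝕜}
    (hv : IsHomogeneousVec deg v m) (hw : IsHomogeneousVec deg w m) :
    IsHomogeneousVec deg (v + w) m := by
  classical
  intro s e he
  rcases Finset.mem_union.1 (MvPolynomial.support_add he) with h | h
  · exact hv s e h
  · exact hw s e h

lemma IsHomogeneousVec.sum {deg : ι → ℕ} {m : ℕ} {α : Type*} (A : Finset α)
    {v : α → ι →₀ MvPolynomial σ 𝕜} (h : ∀ a ∈ A, IsHomogeneousVec deg (v a) m) :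
    IsHomogeneousVec deg (∑ a ∈ A, v a) m :=
  Finset.sum_induction _ (fun w => IsHomogeneousVec deg w m) (fun _ _ => .add) (.zero _ _) h

lemma isHomogeneousVec_single {deg : ι → ℕ} {m : ℕ} (s : ι) (p : MvPolynomial σ 𝕜)
    (h : ∀ e ∈ p.support, e.degree + deg s = m) :
    IsHomogeneousVec deg (Finsupp.single s p) m := by
  classical
  intro t e he
  rw [Finsupp.single_apply] at he
  split_ifs at he with hst
  · exact hst ▸ h e he
  · simp at he

lemma isHomogeneousVec_single_one (deg : ι → ℕ) (s : ι) :
    IsHomogeneousVec deg (Finsupp.single s (1 : MvPolynomial σ 𝕜)) (deg s) := by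
  classical
  refine isHomogeneousVec_single s _ fun e he => ?_
  have : e = 0 := by
    by_contra h
    rw [MvPolynomial.mem_support_iff, MvPolynomial.coeff_one, if_neg (Ne.symm h)] at he
    exact he rfl
  simp [this]

/-- The part of degree `m` of a polynomial, as an element of `R(-c)`. -/
noncomputable def MvPolynomial.shiftedComponent (σ 𝕜 : Type*) [Field 𝕜] (c m : ℕ) :
    MvPolynomial σ 𝕜 →+ MvPolynomial σ 𝕜 :=
  if c ≤ m then (MvPolynomial.homogeneousComponent (m - c)).toAddMonoidHom else 0

lemma MvPolynomial.coeff_shiftedComponent (c m : ℕ) (p : MvPolynomial σ 𝕜) (e : σ →₀ ℕ) :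
    (shiftedComponent σ 𝕜 c m p).coeff e = if e.degree + c = m then p.coeff e else 0 := by
  unfold shiftedComponent
  by_cases h : c ≤ m
  · have : e.degree = m - c ↔ e.degree + c = m := by omega
    simp [h, MvPolynomial.coeff_homogeneousComponent, this]
  · have : ¬ e.degree + c = m := by omega
    simp [h, this]

/-- The part of degree `m` of a vector in the graded free module `⨁ₛ R(-deg s)`. -/
noncomputable def vecComponent (deg : ι → ℕ) (m : ℕ) :
    (ι →₀ MvPolynomial σ 𝕜) →+ (ι →₀ MvPolynomial σ 𝕜) :=
  Finsupp.liftAddHom fun s =>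
    (Finsupp.singleAddHom s).comp (MvPolynomial.shiftedComponent σ 𝕜 (deg s) m)

lemma vecComponent_single (deg : ι → ℕ) (m : ℕ) (s : ι) (p : MvPolynomial σ 𝕜) :
    vecComponent deg m (Finsupp.single s p) =
      Finsupp.single s (MvPolynomial.shiftedComponent σ 𝕜 (deg s) m p) := by
  simp [vecComponent]

lemma isHomogeneousVec_vecComponent (deg : ι → ℕ) (m : ℕ) (v : ι →₀ MvPolynomial σ 𝕜) :
    IsHomogeneousVec deg (vecComponent deg m v) m := by
  induction v using Finsupp.induction_linear with
  | zero => simpa using IsHomogeneousVec.zero deg m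
  | add v w hv hw => simpa using hv.add hw
  | single s p =>
    rw [vecComponent_single]
    refine isHomogeneousVec_single s _ fun e he => ?_
    rw [MvPolynomial.mem_support_iff, MvPolynomial.coeff_shiftedComponent] at he
    by_contra h
    simp [h] at he

/-- A homogeneous functional commutes with taking homogeneous components. -/
lemma coeff_map_vecComponent (deg : ι → ℕ) (ε : (ι →₀ MvPolynomial σ 𝕜) →+ MvPolynomial σ 𝕜)
    (c : ℕ) (hε : ∀ v m, IsHomogeneousVec deg v m → ∀ e ∈ (ε v).support, e.degree + c = m)
    (v : ι →₀ MvPolynomial σ 𝕜) (e : σ →₀ ℕ) :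
    (ε (vecComponent deg (e.degree + c) v)).coeff e = (ε v).coeff e := by
  classical
  induction v using Finsupp.induction_linear with
  | zero => simp
  | add v w hv hw => simp [hv, hw]
  | single s p =>
    induction p using MvPolynomial.induction_on' with
    | add p q hp hq => simp only [Finsupp.single_add, map_add, MvPolynomial.coeff_add, hp, hq]
    | monomial f a =>
      have hom : IsHomogeneousVec deg (Finsupp.single s (MvPolynomial.monomial f a))
          (f.degree + deg s) := by
        refine isHomogeneousVec_single s _ fun e he => ?_
        rw [Finset.mem_singleton.1 (MvPolynomial.support_monomial_subset he)]
      rw [vecComponent_single]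
      by_cases h : f.degree + deg s = e.degree + c
      · congr 3
        ext e'
        rw [MvPolynomial.coeff_shiftedComponent, MvPolynomial.coeff_monomial]
        split_ifs with h₁ h₂ h₂ <;> first | rfl | (subst h₂; exact absurd h h₁)
      · have h0 : MvPolynomial.shiftedComponent σ 𝕜 (deg s) (e.degree + c)
            (MvPolynomial.monomial f a) = 0 := by
          ext e'
          rw [MvPolynomial.coeff_shiftedComponent, MvPolynomial.coeff_monomial]
          split_ifs with h₁ h₂ <;> first | rfl | (subst h₂; exact absurd h₁ h)
        rw [h0, Finsupp.single_zero, map_zero, MvPolynomial.coeff_zero]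
        by_contra hne
        exact h (hε _ _ hom e (MvPolynomial.mem_support_iff.2 (Ne.symm hne))).symm

/-- Any preimage of a homogeneous element may be replaced by its component of the same degree; this
is how comparison maps are made homogeneous. -/
lemma map_vecComponent_of_isHomogeneous {deg : ι → ℕ}
    (ε : (ι →₀ MvPolynomial σ 𝕜) →ₗ[MvPolynomial σ 𝕜] MvPolynomial σ 𝕜)
    (hε : ∀ v m, IsHomogeneousVec deg v m → (ε v).IsHomogeneous m)
    {v : ι →₀ MvPolynomial σ 𝕜} {m : ℕ} (h : (ε v).IsHomogeneous m) :
    ε (vecComponent deg m v) = ε v := by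
  have key : ∀ v m, IsHomogeneousVec deg v m → ∀ e ∈ (ε v).support, e.degree + 0 = m := by
    intro v m hv e he
    rw [add_zero]
    have := hε v m hv (MvPolynomial.mem_support_iff.1 he)
    rwa [Finsupp.degree_eq_weight_one]
  ext e
  by_cases he : e.degree = m
  · have := coeff_map_vecComponent deg ε.toAddMonoidHom 0 key v e
    rw [add_zero, he] at this
    exact this
  · rw [Finsupp.degree_eq_weight_one] at he
    have h1 : MvPolynomial.coeff e (ε v) = 0 := by
      by_contra hne
      exact he (h hne)
    have h2 : MvPolynomial.coeff e (ε (vecComponent deg m v)) = 0 := by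
      by_contra hne
      exact he (hε _ _ (isHomogeneousVec_vecComponent deg m v) hne)
    rw [h1, h2]

lemma map_vecComponent_of_isHomogeneousVec {deg : ι → ℕ} {deg' : κ → ℕ}
    (D : (ι →₀ MvPolynomial σ 𝕜) →ₗ[MvPolynomial σ 𝕜] (κ →₀ MvPolynomial σ 𝕜))
    (hD : ∀ v m, IsHomogeneousVec deg v m → IsHomogeneousVec deg' (D v) m)
    {v : ι →₀ MvPolynomial σ 𝕜} {m : ℕ} (h : IsHomogeneousVec deg' (D v) m) :
    D (vecComponent deg m v) = D v := by
  ext t e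
  by_cases he : e.degree + deg' t = m
  · have := coeff_map_vecComponent deg ((Finsupp.applyAddHom t).comp D.toAddMonoidHom)
      (deg' t) (fun v m hv => hD v m hv t) v e
    rw [he] at this
    exact this
  · have h1 : MvPolynomial.coeff e (D v t) = 0 := by
      by_contra hne
      exact he (h t e (MvPolynomial.mem_support_iff.2 hne))
    have h2 : MvPolynomial.coeff e (D (vecComponent deg m v) t) = 0 := by
      by_contra hne
      exact he (hD _ _ (isHomogeneousVec_vecComponent deg m v) t e
        (MvPolynomial.mem_support_iff.2 hne))
    rw [h1, h2]

lemma isHomogeneousVec_linearCombination {deg : ι → ℕ} {deg' : κ → ℕ}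
    {x : ι → κ →₀ MvPolynomial σ 𝕜} (hx : ∀ s, IsHomogeneousVec deg' (x s) (deg s))
    {v : ι →₀ MvPolynomial σ 𝕜} {m : ℕ} (hv : IsHomogeneousVec deg v m) :
    IsHomogeneousVec deg' (Finsupp.linearCombination (MvPolynomial σ 𝕜) x v) m := by
  classical
  rw [Finsupp.linearCombination_apply, Finsupp.sum]
  refine .sum _ fun s _ t e he => ?_
  obtain ⟨e₁, h₁, e₂, h₂, rfl⟩ := Finset.mem_add.1 (MvPolynomial.support_mul (v s) (x s t) he)
  rw [map_add, add_assoc, hx s t e₂ h₂, hv s e₁ h₁]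

/-- A homogeneous map out of a free module lifts homogeneously as soon as the images of the basis
vectors do. -/
lemma exists_homogeneous_lift {N : Type*} [AddCommMonoid N] [Module (MvPolynomial σ 𝕜) N]
    (deg : ι → ℕ) (deg' : κ → ℕ) (g : (ι →₀ MvPolynomial σ 𝕜) →ₗ[MvPolynomial σ 𝕜] N)
    (D : (κ →₀ MvPolynomial σ 𝕜) →ₗ[MvPolynomial σ 𝕜] N)
    (h : ∀ s, ∃ w, IsHomogeneousVec deg' w (deg s) ∧ D w = g (Finsupp.single s 1)) :
    ∃ φ : (ι →₀ MvPolynomial σ 𝕜) →ₗ[MvPolynomial σ 𝕜] (κ →₀ MvPolynomial σ 𝕜),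
      (∀ v m, IsHomogeneousVec deg v m → IsHomogeneousVec deg' (φ v) m) ∧
        ∀ v, D (φ v) = g v := by
  choose x hx hxg using h
  exact ⟨Finsupp.linearCombination _ x, fun v m => isHomogeneousVec_linearCombination hx,
    Finsupp.map_linearCombination_eq g D hxg⟩

end HomogeneousVectors

/-! ### Comparison of resolutions and invariance of Betti numbers. -/

section Comparison

variable {σ 𝕜 : Type*} [Field 𝕜] {I L : Ideal (MvPolynomial σ 𝕜)}

namespace MinimalGradedFreeResolution

lemma aug_d (F : MinimalGradedFreeResolution I) (v) : F.aug (F.d 0 v) = 0 :=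
  F.exact_zero.apply_apply_eq_zero v

lemma d_d (F : MinimalGradedFreeResolution I) (i v) : F.d i (F.d (i + 1) v) = 0 :=
  (F.exact_succ i).apply_apply_eq_zero v

lemma aug_mem (F : MinimalGradedFreeResolution I) (v) : F.aug v ∈ I :=
  F.range_aug.le ⟨v, rfl⟩

lemma exists_aug_eq (F : MinimalGradedFreeResolution I) {f} (hf : f ∈ I) :
    ∃ v, F.aug v = f :=
  F.range_aug.ge hf

lemma constantCoeff_d (F : MinimalGradedFreeResolution I) (i v s) :
    MvPolynomial.constantCoeff (F.d i v s) = 0 := by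
  have := F.minimal i v s
  rw [← Set.image_univ, MvPolynomial.mem_ideal_span_X_image] at this
  by_contra h
  obtain ⟨i, _, hi⟩ := this 0 (MvPolynomial.mem_support_iff.2 h)
  exact hi rfl

/-- The comparison theorem: an inclusion of ideals lifts to a homogeneous map of resolutions. -/
theorem exists_comparison (F : MinimalGradedFreeResolution I)
    (G : MinimalGradedFreeResolution L) (hIL : I ≤ L) :
    ∃ φ : ∀ i, (F.gens i →₀ MvPolynomial σ 𝕜) →ₗ[MvPolynomial σ 𝕜]
        (G.gens i →₀ MvPolynomial σ 𝕜),
      (∀ v, G.aug (φ 0 v) = F.aug v) ∧ (∀ i v, G.d i (φ (i + 1) v) = φ i (F.d i v)) ∧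
        ∀ i v m, IsHomogeneousVec (F.deg i) v m → IsHomogeneousVec (G.deg i) (φ i v) m := by
  -- The recursion carries liftability of `φ ∘ d` through `G.d i` along with `φ`. Stated so, the
  -- step is uniform in `i`, although exactness at `F₀` involves the augmentation.
  have step : ∀ i, ∀ φ : {φ : (F.gens i →₀ MvPolynomial σ 𝕜) →ₗ[MvPolynomial σ 𝕜]
        (G.gens i →₀ MvPolynomial σ 𝕜) //
        (∀ v m, IsHomogeneousVec (F.deg i) v m → IsHomogeneousVec (G.deg i) (φ v) m) ∧
          ∀ v, ∃ w, G.d i w = φ (F.d i v)},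
      ∃ φ' : {φ : (F.gens (i + 1) →₀ MvPolynomial σ 𝕜) →ₗ[MvPolynomial σ 𝕜]
        (G.gens (i + 1) →₀ MvPolynomial σ 𝕜) //
        (∀ v m, IsHomogeneousVec (F.deg (i + 1)) v m →
          IsHomogeneousVec (G.deg (i + 1)) (φ v) m) ∧
          ∀ v, ∃ w, G.d (i + 1) w = φ (F.d (i + 1) v)},
      ∀ v, G.d i (φ'.1 v) = φ.1 (F.d i v) := by
    rintro i ⟨φ, hφ, hex⟩
    obtain ⟨φ', h1, h2⟩ := exists_homogeneous_lift (F.deg (i + 1)) (G.deg (i + 1))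
      (φ ∘ₗ F.d i) (G.d i) fun s => by
        obtain ⟨w, hw⟩ := hex (Finsupp.single s 1)
        refine ⟨vecComponent (G.deg (i + 1)) (F.deg (i + 1) s) w,
          isHomogeneousVec_vecComponent _ _ _, ?_⟩
        rw [map_vecComponent_of_isHomogeneousVec (G.d i) (G.d_homogeneous i), hw]
        · rfl
        · rw [hw]
          exact hφ _ _ (F.d_homogeneous i _ _ (isHomogeneousVec_single_one _ s))
    refine ⟨⟨φ', h1, fun v => ?_⟩, h2⟩
    refine (G.exact_succ i _).1 ?_
    rw [h2, LinearMap.comp_apply, F.d_d, map_zero]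
  obtain ⟨φ₀, h1, h2⟩ := exists_homogeneous_lift (F.deg 0) (G.deg 0) F.aug G.aug fun s => by
    obtain ⟨w, hw⟩ := G.exists_aug_eq (hIL (F.aug_mem (Finsupp.single s 1)))
    refine ⟨vecComponent (G.deg 0) (F.deg 0 s) w, isHomogeneousVec_vecComponent _ _ _, ?_⟩
    rw [map_vecComponent_of_isHomogeneous G.aug G.aug_homogeneous, hw]
    rw [hw]
    exact F.aug_homogeneous _ _ (isHomogeneousVec_single_one _ s)
  choose next hnext using step
  let φ := fun i => Nat.rec (motive := fun i => {φ : (F.gens i →₀ MvPolynomial σ 𝕜)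
      →ₗ[MvPolynomial σ 𝕜] (G.gens i →₀ MvPolynomial σ 𝕜) //
        (∀ v m, IsHomogeneousVec (F.deg i) v m → IsHomogeneousVec (G.deg i) (φ v) m) ∧
          ∀ v, ∃ w, G.d i w = φ (F.d i v)})
    ⟨φ₀, h1, fun v => (G.exact_zero _).1 (by rw [h2, F.aug_d])⟩ next i
  exact ⟨fun i => (φ i).1, h2, fun i => hnext i (φ i), fun i => (φ i).2.1⟩

lemma constantCoeff_map_apply {α β : Type*} [Finite α]
    (h : (α →₀ MvPolynomial σ 𝕜) →ₗ[MvPolynomial σ 𝕜] (β →₀ MvPolynomial σ 𝕜))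
    {v : α →₀ MvPolynomial σ 𝕜} (hv : ∀ s, MvPolynomial.constantCoeff (v s) = 0) (t : β) :
    MvPolynomial.constantCoeff (h v t) = 0 := by
  have := Fintype.ofFinite α
  rw [Finsupp.map_apply_eq_sum_mul, map_sum]
  exact Finset.sum_eq_zero fun s _ => by rw [map_mul, hv, zero_mul]

/-- An endomorphism of a minimal resolution that lifts zero vanishes modulo the variables. -/
theorem constantCoeff_of_lifts_zero (F : MinimalGradedFreeResolution I)
    (γ : ∀ i, (F.gens i →₀ MvPolynomial σ 𝕜) →ₗ[MvPolynomial σ 𝕜]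
        (F.gens i →₀ MvPolynomial σ 𝕜))
    (h0 : ∀ v, F.aug (γ 0 v) = 0) (h : ∀ i v, F.d i (γ (i + 1) v) = γ i (F.d i v)) (i : ℕ)
    (v : F.gens i →₀ MvPolynomial σ 𝕜) (s : F.gens i) :
    MvPolynomial.constantCoeff (γ i v s) = 0 := by
  -- Half of a null-homotopy: `η` need only satisfy `γ = d η` on boundaries. Then `γ (i + 1) - η d`
  -- lifts through `d (i + 1)`, say to `η'`, and both terms of `γ (i + 1) = d η' + η d` vanish
  -- modulo the variables.
  have key : ∀ i, (∀ v s, MvPolynomial.constantCoeff (γ i v s) = 0) ∧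
      ∃ η : (F.gens i →₀ MvPolynomial σ 𝕜) →ₗ[MvPolynomial σ 𝕜]
        (F.gens (i + 1) →₀ MvPolynomial σ 𝕜),
        ∀ v, γ i (F.d i v) = F.d i (η (F.d i v)) := by
    intro i
    induction i with
    | zero =>
      obtain ⟨η, hη⟩ := Finsupp.exists_lift (γ 0) (F.d 0) fun v => (F.exact_zero _).1 (h0 v)
      refine ⟨fun v s => ?_, η, fun v => (hη _).symm⟩
      rw [← hη]
      exact F.constantCoeff_d 0 _ s
    | succ i ih =>
      obtain ⟨_, η, hη⟩ := ih
      obtain ⟨η', hη'⟩ := Finsupp.exists_lift (γ (i + 1) - η ∘ₗ F.d i) (F.d (i + 1)) fun v =>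
        (F.exact_succ i _).1 (by simp [h, hη])
      have := F.finite_gens i
      refine ⟨fun v s => ?_, η', fun v => ?_⟩
      · have := hη' v
        rw [LinearMap.sub_apply, eq_sub_iff_add_eq] at this
        rw [← this, Finsupp.add_apply, map_add, F.constantCoeff_d, LinearMap.comp_apply,
          constantCoeff_map_apply η (F.constantCoeff_d i v), add_zero]
      · rw [hη']
        simp [F.d_d]
  exact (key i).1 v s

lemma constantCoeff_eq_zero_of_deg_ne {α β : Type*} {deg : α → ℕ} {deg' : β → ℕ}
    (φ : (α →₀ MvPolynomial σ 𝕜) →ₗ[MvPolynomial σ 𝕜] (β →₀ MvPolynomial σ 𝕜))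
    (hφ : ∀ v m, IsHomogeneousVec deg v m → IsHomogeneousVec deg' (φ v) m) {s : α} {t : β}
    (h : deg' t ≠ deg s) :
    MvPolynomial.constantCoeff (φ (Finsupp.single s 1) t) = 0 := by
  by_contra hne
  have := hφ _ _ (isHomogeneousVec_single_one deg s) t 0 (MvPolynomial.mem_support_iff.2 hne)
  rw [map_zero, zero_add] at this
  exact h this

/-- With comparison maps `φ`, `ψ` in both directions, `id - ψ φ` lifts zero and so vanishes modulo
the variables. On basis elements of degree `j` the constant terms thus give `A * B = 1` over `𝕜`,
and ranks bound the sizes. -/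
theorem betti_le (F G : MinimalGradedFreeResolution I) (i j : ℕ) :
    F.betti i j ≤ G.betti i j := by
  classical
  obtain ⟨φ, hφ0, hφ, hφh⟩ := exists_comparison F G le_rfl
  obtain ⟨ψ, hψ0, hψ, hψh⟩ := exists_comparison G F le_rfl
  have hγ := F.constantCoeff_of_lifts_zero (fun i => LinearMap.id - ψ i ∘ₗ φ i)
    (by simp [hψ0, hφ0]) (by simp [hψ, hφ]) i
  have := F.finite_gens i
  have := G.finite_gens i
  have := Fintype.ofFinite (F.gens i)
  have := Fintype.ofFinite (G.gens i)
  let cc := MvPolynomial.constantCoeff (R := 𝕜) (σ := σ)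
  let A : Matrix {s : F.gens i // F.deg i s = j} {s : G.gens i // G.deg i s = j} 𝕜 :=
    fun s t => cc (φ i (Finsupp.single s.1 1) t.1)
  let B : Matrix {s : G.gens i // G.deg i s = j} {s : F.gens i // F.deg i s = j} 𝕜 :=
    fun t s => cc (ψ i (Finsupp.single t.1 1) s.1)
  have hAB : A * B = 1 := by
    ext s u
    have h1 := hγ (Finsupp.single s.1 1) u.1
    rw [LinearMap.sub_apply, Finsupp.sub_apply, map_sub, sub_eq_zero, LinearMap.comp_apply,
      Finsupp.map_apply_eq_sum_mul (ψ i), map_sum] at h1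
    -- Basis elements `t` of degree other than `j` may be added to the sum: degree-preserving maps
    -- have no constant entry there.
    have h2 : (A * B) s u =
        ∑ t, cc (φ i (Finsupp.single s.1 1) t * ψ i (Finsupp.single t 1) u.1) := by
      rw [Matrix.mul_apply, ← Finset.sum_filter_of_ne (p := fun t => G.deg i t = j),
        Finset.sum_subtype (F := inferInstance) _ (p := fun t => G.deg i t = j) (by simp)]
      · simp [A, B, cc]
      · intro t _ ht
        by_contra hne
        refine ht ?_
        rw [map_mul, constantCoeff_eq_zero_of_deg_ne (φ i) (hφh i) (by rwa [s.2]), zero_mul]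
    refine h2.trans (h1.symm.trans ?_)
    rw [LinearMap.id_apply, Finsupp.single_apply, Matrix.one_apply]
    simp only [Subtype.ext_iff]
    split_ifs <;> simp
  have := Matrix.rank_mul_le_left A B
  rw [hAB, Matrix.rank_one] at this
  rw [betti, betti, Nat.card_eq_fintype_card, Nat.card_eq_fintype_card]
  exact this.trans (Matrix.rank_le_card_width A)

theorem gradedBetti_eq (F : MinimalGradedFreeResolution I) (i j : ℕ) :
    gradedBetti I i j = F.betti i j := by
  have h : Nonempty (MinimalGradedFreeResolution I) := ⟨F⟩
  rw [gradedBetti, dif_pos h]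
  exact le_antisymm (betti_le _ _ i j) (betti_le _ _ i j)

end MinimalGradedFreeResolution

end Comparison

/-! ### Linear resolutions. -/

section LinearResolutions

variable {σ 𝕜 : Type*} [Field 𝕜] {α β : Type*}

lemma MvPolynomial.isHomogeneous_iff_degree {p : MvPolynomial σ 𝕜} {k : ℕ} :
    p.IsHomogeneous k ↔ ∀ e ∈ p.support, e.degree = k := by
  simp only [MvPolynomial.mem_support_iff, Finsupp.degree_eq_weight_one]
  rfl

lemma isHomogeneousVec_const_iff {deg : α → ℕ} {c : ℕ} (hdeg : ∀ s, deg s = c)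
    (v : α →₀ MvPolynomial σ 𝕜) (k : ℕ) :
    IsHomogeneousVec deg v (k + c) ↔ ∀ s, (v s).IsHomogeneous k := by
  simp [IsHomogeneousVec, hdeg, MvPolynomial.isHomogeneous_iff_degree]

lemma IsHomogeneousVec.eq_zero_or_exists {deg : α → ℕ} {c : ℕ} (hdeg : ∀ s, deg s = c)
    {v : α →₀ MvPolynomial σ 𝕜} {m : ℕ} (hv : IsHomogeneousVec deg v m) :
    v = 0 ∨ ∃ k, m = k + c := by
  by_cases h : c ≤ m
  · exact .inr ⟨m - c, by omega⟩
  · refine .inl (Finsupp.ext fun s => MvPolynomial.support_eq_empty.1 ?_)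
    refine Finset.eq_empty_of_forall_notMem fun e he => ?_
    have := hv s e he
    rw [hdeg] at this
    omega

/-- A map of free modules given by a matrix of linear forms. -/
def RaisesDegree (g : (α →₀ MvPolynomial σ 𝕜) →ₗ[MvPolynomial σ 𝕜] (β →₀ MvPolynomial σ 𝕜)) :
    Prop :=
  ∀ v k, (∀ s, (v s).IsHomogeneous k) → ∀ t, (g v t).IsHomogeneous (k + 1)

lemma isHomogeneous_single_one (s t : α) :
    (Finsupp.single s (1 : MvPolynomial σ 𝕜) t).IsHomogeneous 0 := by
  classical
  rw [Finsupp.single_apply]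
  split_ifs
  · exact MvPolynomial.isHomogeneous_one _ _
  · exact MvPolynomial.isHomogeneous_zero _ _ _

/-- Linear forms have no constant term, so a linear complex is automatically minimal. -/
lemma RaisesDegree.apply_mem [Finite α]
    {g : (α →₀ MvPolynomial σ 𝕜) →ₗ[MvPolynomial σ 𝕜] (β →₀ MvPolynomial σ 𝕜)}
    (hg : RaisesDegree g) (v : α →₀ MvPolynomial σ 𝕜) (t : β) :
    g v t ∈ Ideal.span (Set.range (MvPolynomial.X : σ → MvPolynomial σ 𝕜)) := by
  have := Fintype.ofFinite α
  rw [Finsupp.map_apply_eq_sum_mul]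
  refine Ideal.sum_mem _ fun s _ => Ideal.mul_mem_left _ _ ?_
  have h := hg _ 0 (isHomogeneous_single_one s) t
  rw [MvPolynomial.isHomogeneous_iff_degree] at h
  rw [← Set.image_univ, MvPolynomial.mem_ideal_span_X_image]
  intro e he
  by_contra! hne
  have : e = 0 := Finsupp.ext fun i => hne i (Set.mem_univ i)
  have h1 := h e he
  simp [this] at h1

lemma RaisesDegree.isHomogeneousVec {deg : α → ℕ} {deg' : β → ℕ} {c : ℕ}
    {g : (α →₀ MvPolynomial σ 𝕜) →ₗ[MvPolynomial σ 𝕜] (β →₀ MvPolynomial σ 𝕜)}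
    (hg : RaisesDegree g) (hdeg : ∀ s, deg s = c + 1) (hdeg' : ∀ t, deg' t = c)
    {v : α →₀ MvPolynomial σ 𝕜} {m : ℕ} (hv : IsHomogeneousVec deg v m) :
    IsHomogeneousVec deg' (g v) m := by
  rcases hv.eq_zero_or_exists hdeg with rfl | ⟨k, rfl⟩
  · rw [map_zero]
    exact .zero _ _
  · rw [show k + (c + 1) = k + 1 + c by ring, isHomogeneousVec_const_iff hdeg']
    exact hg v k ((isHomogeneousVec_const_iff hdeg v k).1 hv)

lemma raisesDegree_of_isHomogeneousVec {deg : α → ℕ} {deg' : β → ℕ} {c : ℕ}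
    {g : (α →₀ MvPolynomial σ 𝕜) →ₗ[MvPolynomial σ 𝕜] (β →₀ MvPolynomial σ 𝕜)}
    (hg : ∀ v m, IsHomogeneousVec deg v m → IsHomogeneousVec deg' (g v) m)
    (hdeg : ∀ s, deg s = c + 1) (hdeg' : ∀ t, deg' t = c) : RaisesDegree g := by
  intro v k hv
  have := hg v _ ((isHomogeneousVec_const_iff hdeg v k).2 hv)
  rwa [show k + (c + 1) = k + 1 + c by ring, isHomogeneousVec_const_iff hdeg'] at this

namespace MinimalGradedFreeResolution

variable {I L : Ideal (MvPolynomial σ 𝕜)}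

/-- The resolution is linear, for an ideal generated in degree `a`. -/
def IsLinear (F : MinimalGradedFreeResolution I) (a : ℕ) : Prop := ∀ i s, F.deg i s = i + a

lemma IsLinear.raisesDegree {F : MinimalGradedFreeResolution I} {a : ℕ} (hF : F.IsLinear a)
    (i : ℕ) : RaisesDegree (F.d i) :=
  raisesDegree_of_isHomogeneousVec (c := i + a) (F.d_homogeneous i)
    (fun s => (hF _ s).trans (by ring)) (hF i)

lemma IsLinear.isHomogeneous_aug {F : MinimalGradedFreeResolution I} {a : ℕ} (hF : F.IsLinear a)
    {v : F.gens 0 →₀ MvPolynomial σ 𝕜} {k : ℕ} (hv : ∀ s, (v s).IsHomogeneous k) :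
    (F.aug v).IsHomogeneous (k + a) :=
  F.aug_homogeneous v _ ((isHomogeneousVec_const_iff (fun s => (hF 0 s).trans (zero_add a)) v k).2 hv)

/-- A resolution whose differentials are given by matrices of linear forms. -/
noncomputable def ofLinear (a : ℕ) (gens : ℕ → Type) (finite_gens : ∀ i, Finite (gens i))
    (d : ∀ i, (gens (i + 1) →₀ MvPolynomial σ 𝕜) →ₗ[MvPolynomial σ 𝕜]
      (gens i →₀ MvPolynomial σ 𝕜))
    (aug : (gens 0 →₀ MvPolynomial σ 𝕜) →ₗ[MvPolynomial σ 𝕜] MvPolynomial σ 𝕜)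
    (hd : ∀ i, RaisesDegree (d i))
    (haug : ∀ v k, (∀ s, (v s).IsHomogeneous k) → (aug v).IsHomogeneous (k + a))
    (range_aug : LinearMap.range aug = I) (exact_zero : Function.Exact (d 0) aug)
    (exact_succ : ∀ i, Function.Exact (d (i + 1)) (d i)) : MinimalGradedFreeResolution I where
  gens := gens
  finite_gens := finite_gens
  deg i _ := i + a
  d := d
  aug := aug
  d_homogeneous i v m := (hd i).isHomogeneousVec (c := i + a) (fun _ => by ring) (fun _ => rfl)
  aug_homogeneous v m hv := by
    rcases hv.eq_zero_or_exists (fun _ => rfl) with rfl | ⟨k, rfl⟩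
    · rw [map_zero]
      exact MvPolynomial.isHomogeneous_zero _ _ _
    · rw [zero_add]
      exact haug v k ((isHomogeneousVec_const_iff (fun _ => rfl) v k).1 hv)
  range_aug := range_aug
  exact_zero := exact_zero
  exact_succ := exact_succ
  minimal i v s := (hd i).apply_mem v s

end MinimalGradedFreeResolution

/-- `I` has a linear resolution with `β i` summands `R(-i-a)` in homological degree `i`. -/
def HasLinearBetti (I : Ideal (MvPolynomial σ 𝕜)) (a : ℕ) (β : ℕ → ℕ) : Prop :=
  ∃ F : MinimalGradedFreeResolution I, F.IsLinear a ∧ ∀ i, Nat.card (F.gens i) = β i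

section

variable {I : Ideal (MvPolynomial σ 𝕜)} {a : ℕ} {β : ℕ → ℕ}

lemma HasLinearBetti.gradedBetti_eq (h : HasLinearBetti I a β) (i : ℕ) :
    gradedBetti I i (i + a) = β i := by
  obtain ⟨F, hF, hβ⟩ := h
  rw [F.gradedBetti_eq, MinimalGradedFreeResolution.betti, ← hβ]
  exact Nat.card_congr (Equiv.subtypeUnivEquiv (hF i))

lemma HasLinearBetti.gradedBetti_eq_zero (h : HasLinearBetti I a β) {i j : ℕ} (hj : j ≠ i + a) :
    gradedBetti I i j = 0 := by
  obtain ⟨F, hF, hβ⟩ := h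
  rw [F.gradedBetti_eq, MinimalGradedFreeResolution.betti]
  have : IsEmpty {s : F.gens i // F.deg i s = j} := ⟨fun s => hj (s.2 ▸ hF i s.1)⟩
  exact Nat.card_of_isEmpty

lemma HasLinearBetti.hasLinearResolution (h : HasLinearBetti I a β) : HasLinearResolution I a := by
  refine ⟨?_, fun i j hj => h.gradedBetti_eq_zero hj⟩
  obtain ⟨F, hF, -⟩ := h
  refine ⟨Set.range fun s => F.aug (Finsupp.single s 1), ?_, ?_⟩
  · rintro _ ⟨s, rfl⟩
    simpa using hF.isHomogeneous_aug (isHomogeneous_single_one s)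
  · have := F.finite_gens 0
    have := Fintype.ofFinite (F.gens 0)
    refine le_antisymm (fun f hf => ?_) (Ideal.span_le.2 ?_)
    · obtain ⟨v, rfl⟩ := F.exists_aug_eq hf
      rw [Finsupp.map_eq_sum_smul]
      exact Ideal.sum_mem _ fun s _ => Ideal.mul_mem_left _ _ (Ideal.subset_span ⟨s, rfl⟩)
    · rintro _ ⟨s, rfl⟩
      exact F.aug_mem _

end

lemma hasLinearBetti_bot (a : ℕ) : HasLinearBetti (⊥ : Ideal (MvPolynomial σ 𝕜)) a 0 := by
  refine ⟨.ofLinear a (fun _ => Empty) (fun _ => inferInstance) 0 0 ?_ ?_ ?_ ?_ ?_,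
    fun _ _ => rfl, fun _ => Nat.card_of_isEmpty (α := Empty)⟩
  · exact fun _ _ _ _ t => t.elim
  · exact fun _ _ _ => MvPolynomial.isHomogeneous_zero _ _ _
  · exact LinearMap.range_zero
  · exact fun v => ⟨fun _ => ⟨0, Subsingleton.elim _ _⟩, fun _ => rfl⟩
  · exact fun _ v => ⟨fun _ => ⟨0, Subsingleton.elim _ _⟩, fun _ => rfl⟩

/-- A family of types with one element in degree zero and none in positive degrees. -/
def unitInDegreeZero : ℕ → Type
  | 0 => Unit
  | _ + 1 => Empty

instance (i : ℕ) : IsEmpty (unitInDegreeZero (i + 1)) := inferInstanceAs (IsEmpty Empty)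

lemma hasLinearBetti_top :
    HasLinearBetti (⊤ : Ideal (MvPolynomial σ 𝕜)) 0 (fun i => if i = 0 then 1 else 0) := by
  refine ⟨.ofLinear 0 unitInDegreeZero ?_ 0 (Finsupp.lapply (α := Unit) ()) ?_ ?_ ?_ ?_ ?_,
    fun _ _ => rfl, ?_⟩
  · rintro (_ | i)
    · exact inferInstanceAs (Finite Unit)
    · infer_instance
  · exact fun _ _ _ _ _ => MvPolynomial.isHomogeneous_zero _ _ _
  · exact fun v k hv => hv ()
  · exact LinearMap.range_eq_top.2 fun f => ⟨Finsupp.single (α := Unit) () f, Finsupp.single_eq_same⟩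
  · refine fun v => ⟨fun h => ⟨0, ?_⟩, ?_⟩
    · ext1 ⟨⟩
      exact h.symm
    · rintro ⟨w, rfl⟩
      rfl
  · exact fun _ v => ⟨fun _ => ⟨0, Subsingleton.elim _ _⟩, fun _ => rfl⟩
  · rintro (_ | i)
    · exact Nat.card_unique (α := Unit)
    · exact Nat.card_of_isEmpty (α := Empty)

end LinearResolutions

/-! ### The mapping cone. -/

section Cone

variable {σ 𝕜 : Type*} [Field 𝕜]

/-- Vectors indexed by a sum of three types. -/
noncomputable def finsuppSumThree (R : Type*) [CommSemiring R] (α β γ : Type) :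
    (α ⊕ β ⊕ γ →₀ R) ≃ₗ[R] (α →₀ R) × (β →₀ R) × (γ →₀ R) :=
  (Finsupp.sumFinsuppLEquivProdFinsupp R).trans
    ((LinearEquiv.refl R _).prodCongr (Finsupp.sumFinsuppLEquivProdFinsupp R))

lemma forall_isHomogeneous_iff {α β γ : Type} (v : α ⊕ β ⊕ γ →₀ MvPolynomial σ 𝕜) (k : ℕ) :
    (∀ s, (v s).IsHomogeneous k) ↔
      (∀ s, ((finsuppSumThree _ α β γ v).1 s).IsHomogeneous k) ∧
      (∀ s, ((finsuppSumThree _ α β γ v).2.1 s).IsHomogeneous k) ∧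
      ∀ s, ((finsuppSumThree _ α β γ v).2.2 s).IsHomogeneous k := by
  rw [Sum.forall, Sum.forall]
  rfl

lemma Function.Exact.conj_linearEquiv {R M₁ M₂ M₃ N₁ N₂ N₃ : Type*} [CommRing R]
    [AddCommGroup M₁] [AddCommGroup M₂] [AddCommGroup M₃] [AddCommGroup N₁] [AddCommGroup N₂]
    [AddCommGroup N₃] [Module R M₁] [Module R M₂] [Module R M₃] [Module R N₁] [Module R N₂]
    [Module R N₃] {f : M₁ →ₗ[R] M₂} {g : M₂ →ₗ[R] M₃} (h : Function.Exact f g)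
    (e₁ : N₁ ≃ₗ[R] M₁) (e₂ : N₂ ≃ₗ[R] M₂) (e₃ : M₃ ≃ₗ[R] N₃) :
    Function.Exact (e₂.symm.toLinearMap ∘ₗ f ∘ₗ e₁.toLinearMap)
      (e₃.toLinearMap ∘ₗ g ∘ₗ e₂.toLinearMap) := by
  intro x
  simp only [LinearMap.comp_apply, LinearEquiv.coe_coe, LinearEquiv.map_eq_zero_iff, Set.mem_range]
  rw [h (e₂ x)]
  constructor
  · rintro ⟨u, hu⟩
    exact ⟨e₁.symm u, by simp [hu]⟩
  · rintro ⟨u, rfl⟩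
    exact ⟨e₁ u, by simp⟩

/-- The family of types `gens` moved up by one degree. -/
def shiftGens (gens : ℕ → Type) : ℕ → Type
  | 0 => Empty
  | i + 1 => gens i

instance (gens : ℕ → Type) : IsEmpty (shiftGens gens 0) := inferInstanceAs (IsEmpty Empty)

namespace MinimalGradedFreeResolution

variable {I L : Ideal (MvPolynomial σ 𝕜)} (F : MinimalGradedFreeResolution I)
  (G : MinimalGradedFreeResolution L)

/-- The differential of `F` moved up by one degree. -/
noncomputable def shiftD : ∀ i, (F.gens i →₀ MvPolynomial σ 𝕜) →ₗ[MvPolynomial σ 𝕜]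
    (shiftGens F.gens i →₀ MvPolynomial σ 𝕜)
  | 0 => 0
  | i + 1 => F.d i

lemma shiftD_d (i : ℕ) (v) : F.shiftD i (F.d i v) = 0 := by
  cases i with
  | zero => rfl
  | succ i => exact F.d_d i v

/-- The differential of the mapping cone of `(p, -φ) : F → F ⊕ G`. -/
noncomputable def coneD (p : MvPolynomial σ 𝕜)
    (φ : ∀ i, (F.gens i →₀ MvPolynomial σ 𝕜) →ₗ[MvPolynomial σ 𝕜]
      (G.gens i →₀ MvPolynomial σ 𝕜)) (i : ℕ) :
    (F.gens (i + 1) →₀ MvPolynomial σ 𝕜) × (G.gens (i + 1) →₀ MvPolynomial σ 𝕜) ×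
        (F.gens i →₀ MvPolynomial σ 𝕜) →ₗ[MvPolynomial σ 𝕜]
      (F.gens i →₀ MvPolynomial σ 𝕜) × (G.gens i →₀ MvPolynomial σ 𝕜) ×
        (shiftGens F.gens i →₀ MvPolynomial σ 𝕜) where
  toFun x := (F.d i x.1 + p • x.2.2, G.d i x.2.1 - φ i x.2.2, -F.shiftD i x.2.2)
  map_add' x y := by
    simp only [Prod.fst_add, Prod.snd_add, map_add, smul_add, Prod.mk_add_mk, Prod.mk.injEq]
    exact ⟨by abel, by abel, by abel⟩
  map_smul' r x := by
    simp only [Prod.smul_fst, Prod.smul_snd, map_smul, Prod.smul_mk, smul_add, smul_sub, smul_neg,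
      smul_comm p r, RingHom.id_apply]

/-- The augmentation of the mapping cone of `(p, -φ) : F → F ⊕ G`. -/
noncomputable def coneAug (p : MvPolynomial σ 𝕜) :
    (F.gens 0 →₀ MvPolynomial σ 𝕜) × (G.gens 0 →₀ MvPolynomial σ 𝕜) ×
        (shiftGens F.gens 0 →₀ MvPolynomial σ 𝕜) →ₗ[MvPolynomial σ 𝕜] MvPolynomial σ 𝕜 where
  toFun x := F.aug x.1 + p * G.aug x.2.1
  map_add' x y := by
    simp only [Prod.fst_add, Prod.snd_add, map_add]
    ring
  map_smul' r x := by
    simp only [Prod.smul_fst, Prod.smul_snd, map_smul, smul_eq_mul, RingHom.id_apply]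
    ring

variable {F G} {p : MvPolynomial σ 𝕜}
  {φ : ∀ i, (F.gens i →₀ MvPolynomial σ 𝕜) →ₗ[MvPolynomial σ 𝕜] (G.gens i →₀ MvPolynomial σ 𝕜)}

lemma range_coneAug : LinearMap.range (coneAug F G p) = I ⊔ Ideal.span {p} * L := by
  ext f
  rw [LinearMap.mem_range, Submodule.mem_sup]
  constructor
  · rintro ⟨⟨u, v, w⟩, rfl⟩
    exact ⟨_, F.aug_mem u, _, Ideal.mul_mem_mul (Ideal.mem_span_singleton_self p) (G.aug_mem v), rfl⟩
  · rintro ⟨g, hg, h, hh, rfl⟩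
    obtain ⟨h', hh', rfl⟩ := Ideal.mem_span_singleton_mul.1 hh
    obtain ⟨u, rfl⟩ := F.exists_aug_eq hg
    obtain ⟨v, rfl⟩ := G.exists_aug_eq hh'
    exact ⟨(u, v, 0), rfl⟩

/-- A relation `f + p g = 0` with `f ∈ I`, `g ∈ L` forces `g ∈ I` because `p` is regular modulo `I`.
A lift `z` of `-g` to `F₀` accounts for the relation, and what is left are cycles of `F` and `G`. -/
lemma exact_coneD_coneAug (h0 : ∀ v, G.aug (φ 0 v) = F.aug v)
    (hp : ∀ f, p * f ∈ I → f ∈ I) : Function.Exact (coneD F G p φ 0) (coneAug F G p) := by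
  rintro ⟨u, v, w⟩
  constructor
  · intro h
    change F.aug u + p * G.aug v = 0 at h
    have hv : G.aug v ∈ I := hp _ (by
      rw [eq_neg_of_add_eq_zero_right h]
      exact I.neg_mem (F.aug_mem u))
    obtain ⟨z, hz⟩ := F.exists_aug_eq (I.neg_mem hv)
    obtain ⟨v', hv'⟩ := (G.exact_zero (v + φ 0 z)).1 (by rw [map_add, h0, hz]; ring)
    obtain ⟨u', hu'⟩ := (F.exact_zero (u - p • z)).1 (by
      rw [map_sub, map_smul, hz, smul_eq_mul, ← h]; ring)
    refine ⟨(u', v', z), Prod.ext ?_ (Prod.ext ?_ (Subsingleton.elim _ _))⟩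
    · change F.d 0 u' + p • z = u
      rw [hu', sub_add_cancel]
    · change G.d 0 v' - φ 0 z = v
      rw [hv', add_sub_cancel_right]
  · rintro ⟨⟨u', v', z⟩, h⟩
    rw [← h]
    change F.aug (F.d 0 u' + p • z) + p * G.aug (G.d 0 v' - φ 0 z) = 0
    rw [map_add, map_sub, F.aug_d, G.aug_d, h0, map_smul, smul_eq_mul]
    ring

/-- Once `z` with `d z = -w` disposes of the third coordinate, the corrected first two are cycles of
`F` and `G`, hence boundaries. -/
lemma exact_coneD_coneD (hφ : ∀ i v, G.d i (φ (i + 1) v) = φ i (F.d i v)) (hp : p ≠ 0) (i : ℕ) :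
    Function.Exact (coneD F G p φ (i + 1)) (coneD F G p φ i) := by
  rintro ⟨u, v, w⟩
  constructor
  · intro h
    obtain ⟨h1, h⟩ := Prod.mk.inj h
    obtain ⟨h2, h3⟩ := Prod.mk.inj h
    change F.gens i →₀ MvPolynomial σ 𝕜 at w
    change F.d i u + p • w = 0 at h1
    change G.d i v - φ i w = 0 at h2
    change -F.shiftD i w = 0 at h3
    -- For `i = 0` the equation `h3` is void; instead the augmentation of `h1` gives `p * F.aug w =
    -- 0`, and `p` is cancelled.
    obtain ⟨z, hz⟩ : ∃ z, F.d i z = -w := by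
      cases i with
      | zero =>
        refine (F.exact_zero (-w)).1 ?_
        have := congrArg F.aug h1
        rw [map_add, F.aug_d, zero_add, map_smul, map_zero, smul_eq_mul] at this
        rw [map_neg, (mul_eq_zero.1 this).resolve_left hp, neg_zero]
      | succ i =>
        refine (F.exact_succ i (-w)).1 ?_
        rw [map_neg]
        exact h3
    obtain ⟨v', hv'⟩ := (G.exact_succ i (v + φ (i + 1) z)).1 (by
      rw [map_add, hφ, hz, map_neg, ← sub_eq_add_neg, h2])
    obtain ⟨u', hu'⟩ := (F.exact_succ i (u - p • z)).1 (by
      rw [map_sub, map_smul, hz, smul_neg, sub_neg_eq_add, h1])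
    refine ⟨(u', v', z), Prod.ext ?_ (Prod.ext ?_ ?_)⟩
    · change F.d (i + 1) u' + p • z = u
      rw [hu', sub_add_cancel]
    · change G.d (i + 1) v' - φ (i + 1) z = v
      rw [hv', add_sub_cancel_right]
    · change -F.d i z = w
      rw [hz, neg_neg]
  · rintro ⟨⟨u', v', z⟩, h⟩
    rw [← h]
    refine Prod.ext ?_ (Prod.ext ?_ ?_)
    · change F.d i (F.d (i + 1) u' + p • z) + p • -F.d i z = 0
      rw [map_add, F.d_d, map_smul, smul_neg, zero_add, add_neg_cancel]
    · change G.d i (G.d (i + 1) v' - φ (i + 1) z) - φ i (-F.d i z) = 0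
      rw [map_sub, G.d_d, hφ, map_neg]
      abel
    · change -F.shiftD i (-F.d i z) = 0
      rw [map_neg, F.shiftD_d, neg_zero, neg_zero]

end MinimalGradedFreeResolution

open MinimalGradedFreeResolution in
/-- The mapping cone of `(x_y, -1) : I(-1) → I ⊕ L(-1)`. -/
theorem HasLinearBetti.sup_span_X_mul {I L : Ideal (MvPolynomial σ 𝕜)} {a : ℕ} {β γ : ℕ → ℕ}
    (hI : HasLinearBetti I (a + 1) β) (hL : HasLinearBetti L a γ) (hIL : I ≤ L) (y : σ)
    (hy : ∀ f, MvPolynomial.X y * f ∈ I → f ∈ I) :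
    HasLinearBetti (I ⊔ Ideal.span {MvPolynomial.X y} * L) (a + 1)
      fun i => β i + γ i + if i = 0 then 0 else β (i - 1) := by
  obtain ⟨F, hF, hβ⟩ := hI
  obtain ⟨G, hG, hγ⟩ := hL
  obtain ⟨φ, h0, hφ, hφh⟩ := exists_comparison F G hIL
  -- `F` starts one degree above `G`, so the entries of the degree-preserving `φ` are linear forms,
  -- as are all other nonzero entries of the cone.
  have hφr : ∀ i, RaisesDegree (φ i) := fun i =>
    raisesDegree_of_isHomogeneousVec (c := i + a) (hφh i) (hF i) (hG i)
  have hfin : ∀ i, Finite (shiftGens F.gens i) := by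
    rintro (_ | i)
    · exact inferInstanceAs (Finite Empty)
    · exact F.finite_gens i
  have hFfin := F.finite_gens
  have hGfin := G.finite_gens
  let e := fun i => finsuppSumThree (MvPolynomial σ 𝕜) (F.gens i) (G.gens i) (shiftGens F.gens i)
  let p : MvPolynomial σ 𝕜 := MvPolynomial.X y
  refine ⟨.ofLinear (a + 1) (fun i => F.gens i ⊕ G.gens i ⊕ shiftGens F.gens i)
    (fun i => inferInstance)
    (fun i => (e i).symm.toLinearMap ∘ₗ coneD F G p φ i ∘ₗ (e (i + 1)).toLinearMap)
    (coneAug F G p ∘ₗ (e 0).toLinearMap) ?_ ?_ ?_ ?_ ?_, fun _ _ => rfl, ?_⟩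
  · intro i v k hv
    obtain ⟨h1, h2, h3⟩ := (forall_isHomogeneous_iff v k).1 hv
    rw [forall_isHomogeneous_iff]
    simp only [LinearMap.comp_apply, LinearEquiv.coe_coe, e, LinearEquiv.apply_symm_apply]
    refine ⟨fun s => ?_, fun s => ?_, fun s => ?_⟩
    · exact (hF.raisesDegree i _ k h1 s).add
        (add_comm 1 k ▸ (MvPolynomial.isHomogeneous_X 𝕜 y).mul (h3 s))
    · exact (hG.raisesDegree i _ k h2 s).sub (hφr i _ k h3 s)
    · cases i with
      | zero => exact s.elim
      | succ i => exact (hF.raisesDegree i _ k h3 s).neg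
  · intro v k hv
    obtain ⟨h1, h2, h3⟩ := (forall_isHomogeneous_iff v k).1 hv
    refine (hF.isHomogeneous_aug h1).add ?_
    rw [show k + (a + 1) = 1 + (k + a) by ring]
    exact (MvPolynomial.isHomogeneous_X 𝕜 y).mul (hG.isHomogeneous_aug h2)
  · rw [LinearMap.range_comp_of_range_eq_top _ (LinearEquiv.range (e 0)), range_coneAug]
  · exact (exact_coneD_coneAug h0 hy).conj_linearEquiv (e 1) (e 0) (LinearEquiv.refl _ _)
  · exact fun i => (exact_coneD_coneD hφ (MvPolynomial.X_ne_zero y) i).conj_linearEquiv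
      (e (i + 2)) (e (i + 1)) (e i).symm
  · intro i
    change Nat.card (F.gens i ⊕ G.gens i ⊕ shiftGens F.gens i) = _
    rw [Nat.card_sum, Nat.card_sum, hβ, hγ, ← add_assoc]
    congr 1
    cases i with
    | zero => exact Nat.card_of_isEmpty (α := Empty)
    | succ i => exact hβ i

end Cone

/-! ### The closed formulas satisfy the cone recursion. -/

section BinomialIdentities

open Finset

/-- The Betti numbers of the `a`-th power of the ideal generated by `c` variables. -/
def powerBetti (c a i : ℕ) : ℕ := (c + a - 1).choose (a + i) * (a + i - 1).choose i

lemma powerBetti_zero_right (c i : ℕ) : powerBetti c 0 i = if i = 0 then 1 else 0 := by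
  cases i with
  | zero => simp [powerBetti]
  | succ i => simp [powerBetti]

lemma powerBetti_zero_left (a i : ℕ) : powerBetti 0 (a + 1) i = 0 := by
  simp only [powerBetti, zero_add, Nat.add_sub_cancel]
  rw [Nat.choose_eq_zero_of_lt (by omega), zero_mul]

lemma powerBetti_succ_succ (c a i : ℕ) :
    powerBetti (c + 1) (a + 1) i = powerBetti c (a + 1) i + powerBetti (c + 1) a i +
      if i = 0 then 0 else powerBetti c (a + 1) (i - 1) := by
  cases i with
  | zero =>
    simp only [powerBetti, add_zero, Nat.choose_zero_right, mul_one, if_true]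
    rw [show c + 1 + (a + 1) - 1 = c + a + 1 by omega, show c + (a + 1) - 1 = c + a by omega,
      show c + 1 + a - 1 = c + a by omega, Nat.choose_succ_succ]
    ring
  | succ i =>
    simp only [powerBetti, Nat.succ_ne_zero, if_false, Nat.add_sub_cancel]
    rw [show c + 1 + (a + 1) - 1 = c + a + 1 by omega, show c + (a + 1) - 1 = c + a by omega,
      show c + 1 + a - 1 = c + a by omega, show a + 1 + (i + 1) = a + i + 1 + 1 by ring,
      show a + 1 + i = a + i + 1 by ring, show a + (i + 1) = a + i + 1 by ring,
      Nat.add_sub_cancel, Nat.add_sub_cancel, Nat.choose_succ_succ (c + a) (a + i + 1),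
      Nat.choose_succ_succ (a + i) i]
    ring

/-- The pure-power terms left over in `mixedBetti_succ_succ` collapse to one product, by Pascal's
rule and `Nat.choose_mul`. -/
lemma powerBetti_add_powerBetti (c a i : ℕ) (ha : 1 ≤ a) :
    (powerBetti c a i + if i = 0 then 0 else powerBetti c (a + 1) (i - 1)) =
      (c + a - 1).choose a * c.choose i := by
  cases i with
  | zero => simp [powerBetti]
  | succ i =>
    simp only [powerBetti, Nat.succ_ne_zero, if_false, Nat.add_sub_cancel]
    cases c with
    | zero =>
      rw [Nat.choose_eq_zero_of_lt (by omega : 0 + a - 1 < a + (i + 1)),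
        Nat.choose_eq_zero_of_lt (by omega : 0 + (a + 1) - 1 < a + 1 + i)]
      simp
    | succ c =>
      have h1 := Nat.choose_mul (n := c + a) (Nat.le_add_right a (i + 1))
      have h2 := Nat.choose_mul (n := c + a) (Nat.le_add_right a i)
      rw [Nat.choose_symm_add] at h1 h2
      rw [Nat.add_sub_cancel_left, Nat.add_sub_cancel] at h1 h2
      rw [show c + 1 + a - 1 = c + a by omega, show c + 1 + (a + 1) - 1 = c + a + 1 by omega,
        show a + 1 + i = a + i + 1 by ring, Nat.add_sub_cancel, Nat.choose_succ_succ (c + a) (a + i),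
        Nat.choose_succ_succ c i, mul_add, ← h1, ← h2, ← add_assoc a i 1, Nat.add_sub_cancel,
        Nat.choose_succ_succ (a + i) i]
      simp only [Nat.succ_eq_add_one]
      ring

/-- The contribution of the generators that involve one of the `t` additional variables. -/
def mixedBetti (c t b r i : ℕ) : ℕ :=
  ∑ j ∈ range r, (c + (b + r) - (j + 1) - 1).choose (b + r - (j + 1)) *
    ∑ l ∈ range t, (l + j).choose j * (c + l).choose i

lemma mixedBetti_eq_sum_Icc (c t b r i : ℕ) :
    mixedBetti c t b r i = ∑ j ∈ Icc 1 r, ∑ l ∈ range t,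
      (l + j - 1).choose (j - 1) * (c + (b + r) - j - 1).choose (b + r - j) * (c + l).choose i := by
  rw [mixedBetti, ← Finset.Ico_add_one_right_eq_Icc, Finset.sum_Ico_eq_sum_range]
  refine sum_congr (by simp) fun j _ => ?_
  rw [mul_sum]
  refine sum_congr rfl fun l _ => ?_
  rw [add_comm 1 j, Nat.add_sub_cancel, ← add_assoc l, Nat.add_sub_cancel]
  ring

lemma sum_choose_mul_choose_add (c t j i : ℕ) :
    (∑ l ∈ range t, (l + j).choose j * (c + l).choose i +
      if i = 0 then 0 else ∑ l ∈ range t, (l + j).choose j * (c + l).choose (i - 1)) =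
      ∑ l ∈ range t, (l + j).choose j * (c + l + 1).choose i := by
  cases i with
  | zero => simp
  | succ i =>
    simp only [Nat.succ_ne_zero, if_false, Nat.add_sub_cancel]
    rw [← sum_add_distrib]
    refine sum_congr rfl fun l _ => ?_
    rw [Nat.choose_succ_succ]
    ring

/-- Pascal's rule in the first factor for `l ≥ 1`, followed by a shift of `l`; the terms `l = 0`
agree. -/
lemma sum_choose_mul_choose_succ (c t j i : ℕ) :
    ∑ l ∈ range (t + 1), (l + (j + 1)).choose (j + 1) * (c + l).choose i =
      ∑ l ∈ range (t + 1), (l + j).choose j * (c + l).choose i +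
        ∑ l ∈ range t, (l + (j + 1)).choose (j + 1) * (c + l + 1).choose i := by
  rw [sum_range_succ', sum_range_succ' _ t]
  simp only [zero_add, Nat.choose_self, one_mul, add_zero]
  rw [add_right_comm, ← sum_add_distrib]
  congr 1
  refine sum_congr rfl fun l _ => ?_
  rw [show l + 1 + (j + 1) = l + j + 1 + 1 by ring, Nat.choose_succ_succ,
    show l + 1 + j = l + j + 1 by ring, show l + (j + 1) = l + j + 1 by ring, ← add_assoc c]
  ring

/-- Pascal's rule splits the rows `j ≥ 1` into the sum for `r` and one over the first `t` values of
`l` with `c + l + 1`. The row `j = 0` has the extra term `N 0 * c.choose i`, which supplies the two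
remaining `powerBetti` terms. -/
lemma mixedBetti_succ_succ (c t b r i : ℕ) (hb : 1 ≤ b) :
    powerBetti c (b + (r + 1)) i + mixedBetti c (t + 1) b (r + 1) i =
      (powerBetti c (b + (r + 1)) i + mixedBetti c t b (r + 1) i) +
      (powerBetti c (b + r) i + mixedBetti c (t + 1) b r i) +
      if i = 0 then 0
        else powerBetti c (b + (r + 1)) (i - 1) + mixedBetti c t b (r + 1) (i - 1) := by
  set N := fun j => (c + (b + (r + 1)) - (j + 1) - 1).choose (b + (r + 1) - (j + 1)) with hN
  have hP := powerBetti_add_powerBetti c (b + r) i (by omega)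
  have hN0 : N 0 = (c + (b + r) - 1).choose (b + r) := by
    rw [hN]
    congr 1
  have hT : (mixedBetti c t b (r + 1) i + if i = 0 then 0 else mixedBetti c t b (r + 1) (i - 1)) =
      ∑ j ∈ range (r + 1), N j * ∑ l ∈ range t, (l + j).choose j * (c + l + 1).choose i := by
    simp only [← sum_choose_mul_choose_add]
    cases i with
    | zero => simp [mixedBetti, N]
    | succ i => simp [mixedBetti, N, mul_add, sum_add_distrib]
  have hS : mixedBetti c (t + 1) b (r + 1) i = mixedBetti c (t + 1) b r i +
      (∑ j ∈ range (r + 1), N j * ∑ l ∈ range t, (l + j).choose j * (c + l + 1).choose i) +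
      N 0 * c.choose i := by
    rw [mixedBetti, sum_range_succ', sum_range_succ' _ r]
    simp only [sum_choose_mul_choose_succ, mul_add, sum_add_distrib]
    rw [sum_range_succ' (fun l => (l + 0).choose 0 * (c + l).choose i)]
    have : ∀ j, c + (b + (r + 1)) - (j + 1 + 1) - 1 = c + (b + r) - (j + 1) - 1 ∧
      b + (r + 1) - (j + 1 + 1) = b + r - (j + 1) := fun j => by omega
    simp only [mixedBetti, N, this, mul_add]
    simp
    ring_nf
  rw [hS, hN0, ← hP, ← hT]
  simp only [← add_assoc]
  split_ifs <;> ring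

end BinomialIdentities

/-! ### Ideals generated by variables, and the induction. -/

section VariableIdeals

variable {𝕜 σ : Type*} [Field 𝕜]

open MvPolynomial

lemma varIdeal_empty : varIdeal 𝕜 (∅ : Finset σ) = ⊥ := by
  simp [varIdeal]

lemma varIdeal_union [DecidableEq σ] (J K : Finset σ) :
    varIdeal 𝕜 (J ∪ K) = varIdeal 𝕜 J + varIdeal 𝕜 K := by
  rw [varIdeal, Finset.coe_union, Set.image_union, Ideal.span_union]
  rfl

lemma varIdeal_insert [DecidableEq σ] (y : σ) (J : Finset σ) :
    varIdeal 𝕜 (insert y J) = varIdeal 𝕜 J + Ideal.span {X y} := by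
  rw [Finset.insert_eq, varIdeal_union, add_comm]
  simp [varIdeal]

lemma varIdeal_mono {J K : Finset σ} (h : J ⊆ K) : varIdeal 𝕜 J ≤ varIdeal 𝕜 K :=
  Ideal.span_mono (Set.image_mono (by exact_mod_cast h))

lemma X_mem_varIdeal {J : Finset σ} {s : σ} (hs : s ∈ J) : X s ∈ varIdeal 𝕜 J :=
  Ideal.subset_span ⟨s, hs, rfl⟩

lemma varIdeal_mul_induction {J : Finset σ} {I : Ideal (MvPolynomial σ 𝕜)}
    {p : MvPolynomial σ 𝕜 → Prop} (h0 : p 0) (hadd : ∀ f g, p f → p g → p (f + g))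
    (hX : ∀ s ∈ J, ∀ f ∈ I, p (X s * f)) {f : MvPolynomial σ 𝕜} (hf : f ∈ varIdeal 𝕜 J * I) :
    p f := by
  refine Submodule.mul_induction_on hf (fun m hm => ?_) hadd
  refine Submodule.span_induction (p := fun m _ => ∀ n ∈ I, p (m * n)) ?_ ?_ ?_ ?_ hm
  · rintro _ ⟨s, hs, rfl⟩ n hn
    exact hX s hs n hn
  · intro n _
    rwa [zero_mul]
  · intro x y _ _ hx hy n hn
    rw [add_mul]
    exact hadd _ _ (hx n hn) (hy n hn)
  · intro r x _ hx n hn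
    rw [smul_mul_assoc, mul_comm x n, ← smul_mul_assoc, mul_comm]
    exact hx _ (I.mul_mem_left r hn)

/-- An ideal stable under dividing by the variable `y`. -/
def DivStable (y : σ) (I : Ideal (MvPolynomial σ 𝕜)) : Prop :=
  ∀ f ∈ I, divMonomial f (Finsupp.single y 1) ∈ I

lemma X_mul_divMonomial_single_of_ne {s y : σ} (h : s ≠ y) (f : MvPolynomial σ 𝕜) :
    divMonomial (X s * f) (Finsupp.single y 1) = X s * divMonomial f (Finsupp.single y 1) := by
  classical
  ext e
  rw [coeff_divMonomial, coeff_X_mul', coeff_X_mul', coeff_divMonomial]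
  have hs : s ∈ (Finsupp.single y 1 + e).support ↔ s ∈ e.support := by
    simp [h.symm]
  simp only [hs]
  split_ifs with hse
  · congr 1
    ext t
    have : 1 ≤ e s := Nat.one_le_iff_ne_zero.2 (Finsupp.mem_support_iff.1 hse)
    simp only [Finsupp.coe_add, Finsupp.coe_tsub, Pi.add_apply, Pi.sub_apply,
      Finsupp.single_apply]
    split_ifs with h1 h2 <;> first | omega | (subst h1; subst h2; omega)
  · rfl

lemma DivStable.varIdeal_mul {y : σ} {J : Finset σ} (hy : y ∉ J)
    {I : Ideal (MvPolynomial σ 𝕜)} (hI : DivStable y I) : DivStable y (varIdeal 𝕜 J * I) := by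
  intro f hf
  refine varIdeal_mul_induction (p := fun f => divMonomial f (Finsupp.single y 1) ∈ varIdeal 𝕜 J * I)
    ?_ ?_ ?_ hf
  · rw [zero_divMonomial]
    exact Ideal.zero_mem _
  · intro f g hf hg
    rw [add_divMonomial]
    exact Ideal.add_mem _ hf hg
  · intro s hs f hf
    rw [X_mul_divMonomial_single_of_ne (ne_of_mem_of_not_mem (Finset.mem_coe.1 hs) hy)]
    exact Ideal.mul_mem_mul (X_mem_varIdeal hs) (hI f hf)

lemma DivStable.varIdeal_pow_mul {y : σ} {J : Finset σ} (hy : y ∉ J)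
    {I : Ideal (MvPolynomial σ 𝕜)} (hI : DivStable y I) (n : ℕ) :
    DivStable y (varIdeal 𝕜 J ^ n * I) := by
  induction n with
  | zero => rwa [pow_zero, one_mul]
  | succ n ih =>
    rw [pow_succ', mul_assoc]
    exact ih.varIdeal_mul hy

lemma divStable_pow_mul_pow {y : σ} {C J : Finset σ} (hC : y ∉ C) (hJ : y ∉ J) (b r : ℕ) :
    DivStable y (varIdeal 𝕜 C ^ b * varIdeal 𝕜 J ^ r) := by
  have h : DivStable y (⊤ : Ideal (MvPolynomial σ 𝕜)) := fun _ _ => trivial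
  have := (h.varIdeal_pow_mul hJ r).varIdeal_pow_mul hC b
  rwa [Ideal.mul_top] at this

/-- Dividing `X y * f` by `y` returns `f`; this supplies the regularity of `y` that the cone
requires. -/
lemma DivStable.mem_of_X_mul_mem {y : σ} {I : Ideal (MvPolynomial σ 𝕜)} (hI : DivStable y I)
    (f : MvPolynomial σ 𝕜) (hf : X y * f ∈ I) : f ∈ I := by
  have := hI _ hf
  rwa [X_mul_divMonomial] at this

/-- A product of factors from `M` and `Y` either avoids `Y` or has one factor in `Y` to pull out.
This is the shape `I + y L` of the cone. -/
lemma Ideal.add_pow_succ_eq {R : Type*} [CommSemiring R] (M Y : Ideal R) (r : ℕ) :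
    (M + Y) ^ (r + 1) = M ^ (r + 1) + Y * (M + Y) ^ r := by
  have hM : M ≤ M + Y := le_sup_left
  have hY : Y ≤ M + Y := le_sup_right
  refine le_antisymm ?_ (sup_le (Ideal.pow_right_mono hM _) ?_)
  · induction r with
    | zero => simp
    | succ r ih =>
      rw [pow_succ' (M + Y) (r + 1), add_mul]
      refine sup_le ((Ideal.mul_mono_right ih).trans ?_) le_sup_right
      rw [mul_add, ← pow_succ' M]
      refine sup_le le_sup_left (le_sup_of_le_right ?_)
      rw [mul_left_comm, pow_succ' (M + Y) r]
      exact Ideal.mul_mono_right (Ideal.mul_mono_left hM)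
  · rw [pow_succ']
    exact Ideal.mul_mono_left hY

lemma Ideal.add_pow_eq_sum {R : Type*} [CommSemiring R] (M Y : Ideal R) (r : ℕ) :
    (M + Y) ^ r = ∑ j ∈ Finset.range (r + 1), Y ^ j * M ^ (r - j) := by
  induction r with
  | zero => simp
  | succ r ih =>
    rw [Ideal.add_pow_succ_eq, ih, Finset.sum_range_succ' _ (r + 1), Finset.mul_sum, add_comm]
    congr 1
    · refine Finset.sum_congr rfl fun j _ => ?_
      rw [← mul_assoc, ← pow_succ', Nat.add_sub_add_right]
    · simp

lemma idealU_eq [DecidableEq σ] (J K : Finset σ) (a b : ℕ) (hab : b ≤ a) :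
    idealU 𝕜 J K a b = varIdeal 𝕜 (J ∩ K) ^ b * varIdeal 𝕜 ((J ∩ K) ∪ (J \ K)) ^ (a - b) := by
  rw [varIdeal_union, Ideal.add_pow_eq_sum, Finset.mul_sum, idealU]
  refine Finset.sum_congr rfl fun j hj => ?_
  rw [mul_left_comm, ← pow_add, show b + (a - b - j) = a - j by
    have := Finset.mem_range.1 hj
    omega]

lemma le_sum_of_mem_varIdeal_pow {J : Finset σ} {a : ℕ} {f : MvPolynomial σ 𝕜}
    (hf : f ∈ varIdeal 𝕜 J ^ a) : ∀ e ∈ f.support, a ≤ ∑ s ∈ J, e s := by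
  classical
  induction a generalizing f with
  | zero => exact fun _ _ => Nat.zero_le _
  | succ a ih =>
    rw [pow_succ'] at hf
    refine varIdeal_mul_induction
      (p := fun f => ∀ e ∈ f.support, a + 1 ≤ ∑ s ∈ J, e s) ?_ ?_ ?_ hf
    · simp
    · intro f g hf hg e he
      exact (Finset.mem_union.1 (support_add he)).elim (hf e) (hg e)
    · intro s hs f hf e he
      rw [support_X_mul, Finset.mem_map] at he
      obtain ⟨e', he', rfl⟩ := he
      have h1 := ih hf e' he'
      have h2 : ∑ t ∈ J, (Finsupp.single s 1 : σ →₀ ℕ) t = 1 := by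
        simp [Finsupp.single_apply, hs]
      simp only [addLeftEmbedding_apply, Finsupp.add_apply, Finset.sum_add_distrib, h2]
      omega

lemma exists_monomial_eq_X_mul {J : Finset σ} {e : σ →₀ ℕ} (h : 1 ≤ ∑ s ∈ J, e s) (c : 𝕜) :
    ∃ s ∈ J, ∃ e', e = Finsupp.single s 1 + e' ∧ monomial e c = X s * monomial e' c := by
  obtain ⟨s, hs, hne⟩ := Finset.exists_ne_zero_of_sum_ne_zero (Nat.one_le_iff_ne_zero.1 h)
  have he : e = Finsupp.single s 1 + (e - Finsupp.single s 1) :=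
    (add_tsub_cancel_of_le (Finsupp.single_le_iff.2 (Nat.one_le_iff_ne_zero.2 hne))).symm
  refine ⟨s, hs, _, he, ?_⟩
  conv_lhs => rw [he]
  rw [X, monomial_mul, one_mul]

lemma sum_single_add_le (J : Finset σ) (s : σ) (e : σ →₀ ℕ) :
    ∑ t ∈ J, (Finsupp.single s 1 + e : σ →₀ ℕ) t ≤ 1 + ∑ t ∈ J, e t := by
  classical
  simp only [Finsupp.add_apply, Finset.sum_add_distrib, Finsupp.single_apply]
  refine Nat.add_le_add_right ?_ _
  rw [Finset.sum_ite_eq]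
  split_ifs <;> simp

/-- Splitting off `b` variables of `K` lowers the `J`-degree by at most `b`, so `r` variables of `J`
still remain. -/
lemma monomial_mem_pow_mul_pow {J K : Finset σ} (c : 𝕜) (b r : ℕ) (e : σ →₀ ℕ)
    (hK : b ≤ ∑ s ∈ K, e s) (hJ : b + r ≤ ∑ s ∈ J, e s) :
    monomial e c ∈ varIdeal 𝕜 K ^ b * varIdeal 𝕜 J ^ r := by
  induction b generalizing e with
  | zero =>
    rw [pow_zero, one_mul]
    induction r generalizing e with
    | zero => simp
    | succ r ih =>
      obtain ⟨s, hs, e', he, hm⟩ := exists_monomial_eq_X_mul (J := J) (e := e) (by omega) c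
      have := sum_single_add_le J s e'
      rw [← he] at this
      rw [hm, pow_succ']
      exact Ideal.mul_mem_mul (X_mem_varIdeal hs) (ih e' (Nat.zero_le _) (by omega))
  | succ b ih =>
    obtain ⟨s, hs, e', he, hm⟩ := exists_monomial_eq_X_mul (J := K) (e := e) (by omega) c
    have h1 := sum_single_add_le J s e'
    have h2 := sum_single_add_le K s e'
    rw [← he] at h1 h2
    rw [hm, pow_succ', mul_assoc]
    exact Ideal.mul_mem_mul (X_mem_varIdeal hs) (ih e' (by omega) (by omega))

lemma varIdeal_pow_inf_varIdeal_pow {J K : Finset σ} (h : K ⊆ J) {a b : ℕ} (hab : b ≤ a) :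
    varIdeal 𝕜 J ^ a ⊓ varIdeal 𝕜 K ^ b = varIdeal 𝕜 K ^ b * varIdeal 𝕜 J ^ (a - b) := by
  refine le_antisymm (fun f hf => ?_) (le_inf ?_ Ideal.mul_le_left)
  · rw [f.as_sum]
    refine Ideal.sum_mem _ fun e he => monomial_mem_pow_mul_pow _ b (a - b) e
      (le_sum_of_mem_varIdeal_pow hf.2 e he) ?_
    rw [Nat.add_sub_cancel' hab]
    exact le_sum_of_mem_varIdeal_pow hf.1 e he
  · calc varIdeal 𝕜 K ^ b * varIdeal 𝕜 J ^ (a - b)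
        ≤ varIdeal 𝕜 J ^ b * varIdeal 𝕜 J ^ (a - b) :=
          Ideal.mul_mono_left (Ideal.pow_right_mono (varIdeal_mono h) b)
      _ = varIdeal 𝕜 J ^ a := by rw [← pow_add, Nat.add_sub_cancel' hab]

lemma HasLinearBetti.pow_mul_pow_insert [DecidableEq σ] {C J : Finset σ} {y : σ} (hC : y ∉ C)
    (hJ : y ∉ J) {a b r : ℕ} {β γ : ℕ → ℕ}
    (hβ : HasLinearBetti (varIdeal 𝕜 C ^ b * varIdeal 𝕜 J ^ (r + 1)) (a + 1) β)
    (hγ : HasLinearBetti (varIdeal 𝕜 C ^ b * varIdeal 𝕜 (insert y J) ^ r) a γ) :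
    HasLinearBetti (varIdeal 𝕜 C ^ b * varIdeal 𝕜 (insert y J) ^ (r + 1)) (a + 1)
      fun i => β i + γ i + if i = 0 then 0 else β (i - 1) := by
  have h := hβ.sup_span_X_mul hγ (Ideal.mul_mono_right ((Ideal.pow_le_pow_right r.le_succ).trans
    (Ideal.pow_right_mono (varIdeal_mono (Finset.subset_insert y J)) r))) y
    (divStable_pow_mul_pow hC hJ b (r + 1)).mem_of_X_mul_mem
  rwa [mul_left_comm, ← Submodule.add_eq_sup, ← mul_add, varIdeal_insert, ← Ideal.add_pow_succ_eq,
    ← varIdeal_insert] at h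

theorem hasLinearBetti_varIdeal_pow (C : Finset σ) (a : ℕ) :
    HasLinearBetti (varIdeal 𝕜 C ^ a) a (powerBetti C.card a) := by
  classical
  have h0 : ∀ C : Finset σ, HasLinearBetti (varIdeal 𝕜 C ^ 0) 0 (powerBetti C.card 0) := by
    intro C
    rw [pow_zero, Ideal.one_eq_top, funext (powerBetti_zero_right C.card)]
    exact hasLinearBetti_top
  induction C using Finset.induction_on generalizing a with
  | empty =>
    cases a with
    | zero => exact h0 ∅
    | succ a =>
      rw [varIdeal_empty, Ideal.bot_pow a.succ_ne_zero, Finset.card_empty,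
        funext (powerBetti_zero_left a)]
      exact hasLinearBetti_bot _
  | insert y C hy ih =>
    induction a with
    | zero => exact h0 _
    | succ a ih' =>
      -- With `b = 0` the left factor is the unit ideal, so the mixed step specializes to pure
      -- powers.
      have := HasLinearBetti.pow_mul_pow_insert (C := ∅) (b := 0) (Finset.notMem_empty y) hy
        (by simpa using ih (a + 1)) (by simpa using ih')
      rw [Finset.card_insert_of_notMem hy] at this ⊢
      rw [pow_zero, one_mul] at this
      rwa [funext (powerBetti_succ_succ C.card a)]

/-- Double induction: the cone for `(insert y A, r + 1)` uses `(A, r + 1)` and `(insert y A, r)`.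
Both boundary cases, `A = ∅` and `r = 0`, are pure powers of `𝔪_C`. -/
theorem hasLinearBetti_pow_mul_pow [DecidableEq σ] (C A : Finset σ) (hCA : Disjoint C A) (b r : ℕ)
    (hb : 1 ≤ b) :
    HasLinearBetti (varIdeal 𝕜 C ^ b * varIdeal 𝕜 (C ∪ A) ^ r) (b + r)
      (fun i => powerBetti C.card (b + r) i + mixedBetti C.card A.card b r i) := by
  induction A using Finset.induction_on generalizing r with
  | empty =>
    rw [Finset.union_empty, ← pow_add]
    simpa [mixedBetti] using hasLinearBetti_varIdeal_pow C (b + r)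
  | insert y A hy ih =>
    obtain ⟨hyC, hCA'⟩ := Finset.disjoint_insert_right.1 hCA
    induction r with
    | zero => simpa [mixedBetti] using hasLinearBetti_varIdeal_pow C b
    | succ r ih' =>
      rw [Finset.union_insert] at ih' ⊢
      have := (ih hCA' (r + 1)).pow_mul_pow_insert hyC (by simp [hyC, hy]) ih'
      rw [Finset.card_insert_of_notMem hy] at this ⊢
      rwa [funext fun i => mixedBetti_succ_succ C.card A.card b r i hb]

theorem hasLinearBetti_idealU [DecidableEq σ] (J K : Finset σ) {a b : ℕ} (hb : 1 ≤ b)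
    (hab : b ≤ a) : HasLinearBetti (idealU 𝕜 J K a b) a fun i =>
      ((J ∩ K).card + a - 1).choose (a + i) * (a + i - 1).choose i +
        ∑ j ∈ Finset.Icc 1 (a - b), ∑ l ∈ Finset.range (J \ K).card,
          (l + j - 1).choose (j - 1) * ((J ∩ K).card + a - j - 1).choose (a - j) *
            ((J ∩ K).card + l).choose i := by
  have h := hasLinearBetti_pow_mul_pow (𝕜 := 𝕜) (J ∩ K) (J \ K)
    (Finset.disjoint_sdiff_inter J K).symm b (a - b) hb
  simp only [mixedBetti_eq_sum_Icc, Nat.add_sub_cancel' hab] at h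
  rw [idealU_eq J K a b hab]
  exact h

end VariableIdeals

theorem theorem5p5 {𝕜 : Type*} [Field 𝕜] (n : ℕ) (J K : Finset (Fin n)) (a b : ℕ)
    (hb : 1 ≤ b) (hab : b ≤ a) :
    ((∀ i, gradedBetti (idealU 𝕜 J K a b) i (i + a) =
        ((J ∩ K).card + a - 1).choose (a + i) * (a + i - 1).choose i +
          ∑ j ∈ Finset.Icc 1 (a - b), ∑ l ∈ Finset.range (J \ K).card,
            (l + j - 1).choose (j - 1) * ((J ∩ K).card + a - j - 1).choose (a - j) *
              ((J ∩ K).card + l).choose i) ∧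
      (∀ i j, j ≠ i + a → gradedBetti (idealU 𝕜 J K a b) i j = 0) ∧
      HasLinearResolution (idealU 𝕜 J K a b) a) ∧
    (K ⊆ J →
      (∀ i, gradedBetti (varIdeal 𝕜 J ^ a ⊓ varIdeal 𝕜 K ^ b) i (i + a) =
        (K.card + a - 1).choose (a + i) * (a + i - 1).choose i +
          ∑ j ∈ Finset.Icc 1 (a - b), ∑ l ∈ Finset.range (J \ K).card,
            (l + j - 1).choose (j - 1) * (K.card + a - j - 1).choose (a - j) *
              (K.card + l).choose i) ∧
      (∀ i j, j ≠ i + a → gradedBetti (varIdeal 𝕜 J ^ a ⊓ varIdeal 𝕜 K ^ b) i j = 0)) := by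
  have h := hasLinearBetti_idealU (𝕜 := 𝕜) J K hb hab
  refine ⟨⟨h.gradedBetti_eq, fun i j => h.gradedBetti_eq_zero, h.hasLinearResolution⟩, fun hKJ => ?_⟩
  have hJK : J ∩ K = K := Finset.inter_eq_right.2 hKJ
  have hI : varIdeal 𝕜 J ^ a ⊓ varIdeal 𝕜 K ^ b = idealU 𝕜 J K a b := by
    rw [varIdeal_pow_inf_varIdeal_pow hKJ hab, idealU_eq J K a b hab, hJK,
      Finset.union_sdiff_of_subset hKJ]
  rw [hJK] at h
  rw [hI]
  exact ⟨h.gradedBetti_eq, fun i j => h.gradedBetti_eq_zero⟩
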